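/- Let $\Lambda$ and $\Gamma$ be arbitrary (unital, associative) rings, let $M$ be a $(\Lambda,\Gamma)$-bimodule, and let $$T=\begin{pmatrix}\Lambda & M\\ 0 & \Gamma\end{pmatrix}$$ be the upper triangular matrix ring. A left module $G$ over a ring $R$ is called Gorenstein projective if there is an exact complex $\cdots\to Q_1\to Q_0\to Q^0\to Q^1\to\cdots$ of projective left $R$-modules which remains exact after applying $\operatorname{Hom}_R(-,P)$ for every projective left $R$-module $P$, and such that $G\cong\operatorname{Im}(Q_0\to Q^0)$. A ring $R$ is called strongly left CM-free if every Gorenstein projective left $R$-module (not necessarily finitely generated) is projective. Assume that the right $\Gamma$-module $M_\Gamma$ has finite flat dimension and that the left $\Lambda$-module ${}_\Lambda M$ has finite projective dimension. Then $T$ is strongly left CM-free if and only if both $\Lambda$ and $\Gamma$ are strongly left CM-free. -/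

import Mathlib

open CategoryTheory

open scoped TensorProduct

universe v u

namespace TriCM

section Gorenstein

variable {C : Type u} [Category.{v} C] [Abelian C]

/-- A complete projective resolution in an abelian category: an exact complex
`⋯ → K⁻¹ → K⁰ → K¹ → ⋯` of projective objects such that the complex `Hom(K, P)` is exact
for every projective object `P`, i.e. every `f : K^{i+1} ⟶ P` that vanishes on the incoming
differential factors through the outgoing one. -/
structure IsCompleteProjectiveResolution (K : CochainComplex C ℤ) : Prop where
  projective (i : ℤ) : Projective (K.X i)
  acyclic : K.Acyclic
  hom_exact (P : C) (_ : Projective P) (i : ℤ) (f : K.X (i + 1) ⟶ P)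
    (_ : K.d i (i + 1) ≫ f = 0) :
    ∃ g : K.X (i + 1 + 1) ⟶ P, K.d (i + 1) (i + 1 + 1) ≫ g = f

/-- An object is Gorenstein projective if it is isomorphic to the image of the differential
`K⁻¹ ⟶ K⁰` of some complete projective resolution `K`. -/
def IsGorensteinProjective (G : C) : Prop :=
  ∃ K : CochainComplex C ℤ, IsCompleteProjectiveResolution K ∧
    Nonempty (G ≅ Limits.image (K.d (-1) 0))

end Gorenstein

/-- A ring `R` is strongly left CM-free if every Gorenstein projective left `R`-module
(not necessarily finitely generated) is projective. -/
def StronglyLeftCMFree (R : Type u) [Ring R] : Prop :=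
  ∀ G : ModuleCat.{u} R, IsGorensteinProjective G → Projective G

section Flat

variable (Γ : Type u) [Ring Γ]

/-- The subgroup of `M ⊗[ℤ] N` generated by the elements `(m γ) ⊗ n - m ⊗ (γ n)`, for a right
`Γ`-module `M` and a left `Γ`-module `N`. -/
def balancedRelations (M : Type u) [AddCommGroup M] [Module Γᵐᵒᵖ M]
    (N : Type u) [AddCommGroup N] [Module Γ N] : AddSubgroup (M ⊗[ℤ] N) :=
  AddSubgroup.closure
    {x | ∃ (m : M) (γ : Γ) (n : N), x = (MulOpposite.op γ • m) ⊗ₜ[ℤ] n - m ⊗ₜ[ℤ] (γ • n)}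

/-- The tensor product `M ⊗_Γ N` of a right module and a left module over a ring that need not
be commutative. -/
abbrev BalancedTensor (M : Type u) [AddCommGroup M] [Module Γᵐᵒᵖ M]
    (N : Type u) [AddCommGroup N] [Module Γ N] : Type u :=
  (M ⊗[ℤ] N) ⧸ balancedRelations Γ M N

/-- The additive map `M ⊗_Γ f : M ⊗_Γ N → M ⊗_Γ N'`, `m ⊗ n ↦ m ⊗ f n`. -/
def balancedTensorMap (M : Type u) [AddCommGroup M] [Module Γᵐᵒᵖ M]
    {N N' : Type u} [AddCommGroup N] [Module Γ N] [AddCommGroup N'] [Module Γ N']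
    (f : N →ₗ[Γ] N') : BalancedTensor Γ M N →+ BalancedTensor Γ M N' :=
  QuotientAddGroup.map (balancedRelations Γ M N) (balancedRelations Γ M N')
    (TensorProduct.map (LinearMap.id : M →ₗ[ℤ] M)
      f.toAddMonoidHom.toIntLinearMap).toAddMonoidHom (by
      refine (AddSubgroup.closure_le _).2 ?_
      rintro _ ⟨m, γ, n, rfl⟩
      refine AddSubgroup.subset_closure ⟨m, γ, f n, ?_⟩
      change TensorProduct.map _ _ (_ ⊗ₜ[ℤ] n - m ⊗ₜ[ℤ] (γ • n)) = _
      rw [map_sub, TensorProduct.map_tmul, TensorProduct.map_tmul]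
      change _ - m ⊗ₜ[ℤ] f (γ • n) = _
      rw [f.map_smul]
      rfl)

/-- A right `Γ`-module `M` is flat if `M ⊗_Γ -` preserves injectivity of maps of left
`Γ`-modules. -/
def IsFlatRight (M : Type u) [AddCommGroup M] [Module Γᵐᵒᵖ M] : Prop :=
  ∀ (N N' : Type u) [AddCommGroup N] [Module Γ N] [AddCommGroup N'] [Module Γ N']
    (f : N →ₗ[Γ] N'), Function.Injective f → Function.Injective (balancedTensorMap Γ M f)

/-- A right `Γ`-module `M` has finite flat dimension if for some `n` there is an exact sequence
`0 → Fₙ → ⋯ → F₁ → F₀ → M → 0` of right `Γ`-modules with all `Fᵢ` flat. -/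
def HasFiniteFlatDimensionRight (M : Type u) [AddCommGroup M] [Module Γᵐᵒᵖ M] : Prop :=
  ∃ (n : ℕ) (F : ℕ → ModuleCat.{u} Γᵐᵒᵖ) (d : ∀ i, F (i + 1) →ₗ[Γᵐᵒᵖ] F i)
    (ε : F 0 →ₗ[Γᵐᵒᵖ] M),
    (∀ i, IsFlatRight Γ (F i)) ∧ (∀ i, n < i → Subsingleton (F i)) ∧
    Function.Surjective ε ∧ Function.Exact (d 0) ε ∧ ∀ i, Function.Exact (d (i + 1)) (d i)

end Flat

/-- A left module has finite projective dimension. -/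
def HasFiniteProjectiveDimension (R : Type u) [Ring R] (M : Type u) [AddCommGroup M]
    [Module R M] : Prop :=
  ∃ n : ℕ, HasProjectiveDimensionLE (ModuleCat.of R M) n

/-- The upper triangular matrices `(a m; 0 b)` with `a ∈ Λ`, `m ∈ M`, `b ∈ Γ`. -/
@[ext]
structure UpperTriangular (Λ M Γ : Type u) : Type u where
  a : Λ
  m : M
  b : Γ

namespace UpperTriangular

variable {Λ M Γ : Type u} [Ring Λ] [Ring Γ] [AddCommGroup M]

instance : Zero (UpperTriangular Λ M Γ) := ⟨⟨0, 0, 0⟩⟩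
instance : One (UpperTriangular Λ M Γ) := ⟨⟨1, 0, 1⟩⟩
instance : Add (UpperTriangular Λ M Γ) := ⟨fun x y => ⟨x.a + y.a, x.m + y.m, x.b + y.b⟩⟩
instance : Neg (UpperTriangular Λ M Γ) := ⟨fun x => ⟨-x.a, -x.m, -x.b⟩⟩

@[simp] theorem zero_a : (0 : UpperTriangular Λ M Γ).a = 0 := rfl
@[simp] theorem zero_m : (0 : UpperTriangular Λ M Γ).m = 0 := rfl
@[simp] theorem zero_b : (0 : UpperTriangular Λ M Γ).b = 0 := rfl
@[simp] theorem one_a : (1 : UpperTriangular Λ M Γ).a = 1 := rfl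
@[simp] theorem one_m : (1 : UpperTriangular Λ M Γ).m = 0 := rfl
@[simp] theorem one_b : (1 : UpperTriangular Λ M Γ).b = 1 := rfl
@[simp] theorem add_a (x y : UpperTriangular Λ M Γ) : (x + y).a = x.a + y.a := rfl
@[simp] theorem add_m (x y : UpperTriangular Λ M Γ) : (x + y).m = x.m + y.m := rfl
@[simp] theorem add_b (x y : UpperTriangular Λ M Γ) : (x + y).b = x.b + y.b := rfl
@[simp] theorem neg_a (x : UpperTriangular Λ M Γ) : (-x).a = -x.a := rfl
@[simp] theorem neg_m (x : UpperTriangular Λ M Γ) : (-x).m = -x.m := rfl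
@[simp] theorem neg_b (x : UpperTriangular Λ M Γ) : (-x).b = -x.b := rfl

instance : AddCommGroup (UpperTriangular Λ M Γ) where
  add_assoc x y z := by ext <;> simp [add_assoc]
  zero_add x := by ext <;> simp
  add_zero x := by ext <;> simp
  add_comm x y := by ext <;> simp [add_comm]
  neg_add_cancel x := by ext <;> simp
  nsmul := nsmulRec
  zsmul := zsmulRec

variable [Module Λ M] [Module Γᵐᵒᵖ M]

/-- Matrix multiplication: the upper right entry of the product is `a m' + m b'`. -/
instance : Mul (UpperTriangular Λ M Γ) :=
  ⟨fun x y => ⟨x.a * y.a, x.a • y.m + MulOpposite.op y.b • x.m, x.b * y.b⟩⟩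

@[simp] theorem mul_a (x y : UpperTriangular Λ M Γ) : (x * y).a = x.a * y.a := rfl
@[simp] theorem mul_m (x y : UpperTriangular Λ M Γ) :
    (x * y).m = x.a • y.m + MulOpposite.op y.b • x.m := rfl
@[simp] theorem mul_b (x y : UpperTriangular Λ M Γ) : (x * y).b = x.b * y.b := rfl

/-- The upper triangular matrix ring of two rings and a bimodule. -/
instance [SMulCommClass Λ Γᵐᵒᵖ M] : Ring (UpperTriangular Λ M Γ) where
  __ := (inferInstance : AddCommGroup (UpperTriangular Λ M Γ))
  left_distrib x y z := by
    ext
    · simp [mul_add]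
    · simp only [mul_m, add_m, add_b, MulOpposite.op_add, smul_add, add_smul]
      abel
    · simp [mul_add]
  right_distrib x y z := by
    ext
    · simp [add_mul]
    · simp only [mul_m, add_m, add_a, smul_add, add_smul]
      abel
    · simp [add_mul]
  zero_mul x := by ext <;> simp
  mul_zero x := by ext <;> simp
  mul_assoc x y z := by
    ext
    · simp [mul_assoc]
    · simp [mul_smul, smul_comm, add_assoc]
    · simp [mul_assoc]
  one_mul x := by ext <;> simp
  mul_one x := by ext <;> simp

end UpperTriangular

end TriCM

/-!
A ring is strongly left CM-free exactly when `Hom(K, W)` is exact for every complete projective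
resolution `K` of modules and every module `W`. If `F ⊣ G`, then `Hom(F K, W) = Hom(K, G W)`, so
`F K` is a complete projective resolution as soon as `Hom(K, G P)` and `Hom(K, G J)` are exact for
all projective `P` and all injective `J`; CM-freeness of the target of `F` then makes every
`Hom(K, G W)` exact.

Let `e` and `f` be the diagonal idempotents of `T`. A `T`-module `W` sits in a short exact sequence
`0 → e W → W → f W → 0`, so it suffices to treat the restrictions to `T` of `Λ`-modules and of
`Γ`-modules. Both these restrictions and the functors `W ↦ e W` and `W ↦ f W` are right adjoints,
to which the above applies. The functor `W ↦ e W` sends `T` to `Λ ⊕ M`, so on projectives it is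
controlled by the finite projective dimension of `M`. Every injective `T`-module is a retract of
`Hom_ℤ(T, D)` for some divisible group `D`, and `W ↦ f W` sends this module to
`Hom_ℤ(M, D) ⊕ Hom_ℤ(Γ, D)`, so on injectives it is controlled by the finite flat dimension of `M`.
-/

namespace TriCM

section HomExact

variable {C : Type u} [Category.{v} C] [Abelian C] {K : CochainComplex C ℤ}

/-- Exactness of the complex `Hom(K, W)`, in the form used in `IsCompleteProjectiveResolution`. The
indices are tied by equations rather than substituted so that they can be translated freely. -/
def HomExact (K : CochainComplex C ℤ) (W : C) : Prop :=
  ∀ ⦃i j k : ℤ⦄, i + 1 = j → j + 1 = k → ∀ f : K.X j ⟶ W, K.d i j ≫ f = 0 →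
    ∃ g : K.X k ⟶ W, K.d j k ≫ g = f

theorem acyclic_iff_exact_sc' :
    K.Acyclic ↔ ∀ ⦃i j k : ℤ⦄, i + 1 = j → j + 1 = k → (K.sc' i j k).Exact := by
  constructor
  · intro h i j k hij hjk
    exact (K.exactAt_iff' i j k (by rw [CochainComplex.prev]; omega)
      (by rw [CochainComplex.next]; omega)).1 (h j)
  · intro h j
    exact (K.exactAt_iff' (j - 1) j (j + 1) (by simp) (by simp)).2 (h (by omega) rfl)

namespace HomExact

theorem of_retract {W W' : C} (h : HomExact K W') (r : Retract W W') : HomExact K W := by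
  intro i j k hij hjk f hf
  obtain ⟨g, hg⟩ := h hij hjk (f ≫ r.i) (by rw [reassoc_of% hf, Limits.zero_comp])
  exact ⟨g ≫ r.r, by rw [reassoc_of% hg, r.retract, Category.comp_id]⟩

theorem biprod {W W' : C} (h : HomExact K W) (h' : HomExact K W') : HomExact K (W ⊞ W') := by
  intro i j k hij hjk f hf
  obtain ⟨g, hg⟩ := h hij hjk (f ≫ Limits.biprod.fst) (by rw [reassoc_of% hf, Limits.zero_comp])
  obtain ⟨g', hg'⟩ := h' hij hjk (f ≫ Limits.biprod.snd) (by rw [reassoc_of% hf, Limits.zero_comp])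
  exact ⟨Limits.biprod.lift g g', by ext <;> simp [hg, hg']⟩

theorem of_injective (hK : K.Acyclic) (J : C) [Injective J] : HomExact K J := by
  intro i j k hij hjk f hf
  have hex := acyclic_iff_exact_sc'.1 hK hij hjk
  exact ⟨hex.descToInjective f hf, hex.comp_descToInjective f hf⟩

section TwoOutOfThree

variable {S : ShortComplex C} (hS : S.ShortExact) (hK : ∀ i, Projective (K.X i))
include hS hK

theorem middle (h₁ : HomExact K S.X₁) (h₃ : HomExact K S.X₃) : HomExact K S.X₂ := by
  intro i j k hij hjk f hf
  have := hK k
  have := hS.mono_f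
  have := hS.epi_g
  obtain ⟨q, hq⟩ := h₃ hij hjk (f ≫ S.g) (by rw [reassoc_of% hf, Limits.zero_comp])
  let q' := Projective.factorThru q S.g
  have hq' : (f - K.d j k ≫ q') ≫ S.g = 0 := by simp [q', hq]
  let p := hS.exact.lift _ hq'
  have hp : p ≫ S.f = f - K.d j k ≫ q' := hS.exact.lift_f _ hq'
  obtain ⟨p', hp'⟩ := h₁ hij hjk p (by
    rw [← cancel_mono S.f, Category.assoc, hp]
    simp [hf])
  exact ⟨p' ≫ S.f + q', by rw [Preadditive.comp_add, reassoc_of% hp', hp, sub_add_cancel]⟩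

theorem right (h₁ : HomExact K S.X₁) (h₂ : HomExact K S.X₂) : HomExact K S.X₃ := by
  intro i j k hij hjk f hf
  have := hK i
  have := hK j
  have := hS.mono_f
  have := hS.epi_g
  let f' := Projective.factorThru f S.g
  have hf' : f' ≫ S.g = f := Projective.factorThru_comp _ _
  have hdf' : (K.d i j ≫ f') ≫ S.g = 0 := by rw [Category.assoc, hf', hf]
  let p := hS.exact.lift _ hdf'
  have hp : p ≫ S.f = K.d i j ≫ f' := hS.exact.lift_f _ hdf'
  obtain ⟨p', hp'⟩ := h₁ (sub_add_cancel i 1) hij p (by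
    rw [← cancel_mono S.f, Category.assoc, hp]
    simp)
  obtain ⟨g, hg⟩ := h₂ hij hjk (f' - p' ≫ S.f) (by
    rw [Preadditive.comp_sub, reassoc_of% hp', hp, sub_self])
  exact ⟨g ≫ S.g, by simp [reassoc_of% hg, hf']⟩

theorem left (h₂ : HomExact K S.X₂) (h₃ : HomExact K S.X₃) : HomExact K S.X₁ := by
  intro i j k hij hjk f hf
  have := hK (k + 1)
  have := hK k
  have := hS.mono_f
  have := hS.epi_g
  obtain ⟨g, hg⟩ := h₂ hij hjk (f ≫ S.f) (by rw [reassoc_of% hf, Limits.zero_comp])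
  obtain ⟨q, hq⟩ := h₃ hjk rfl (g ≫ S.g) (by rw [reassoc_of% hg, S.zero, Limits.comp_zero])
  let q' := Projective.factorThru q S.g
  have hq' : (g - K.d k (k + 1) ≫ q') ≫ S.g = 0 := by simp [q', hq]
  refine ⟨hS.exact.lift _ hq', ?_⟩
  rw [← cancel_mono S.f, Category.assoc, hS.exact.lift_f]
  simp [hg]

end TwoOutOfThree

theorem of_hasProjectiveDimensionLT [EnoughProjectives C] (hK : ∀ i, Projective (K.X i))
    (hP : ∀ P : C, Projective P → HomExact K P) (n : ℕ) (X : C) [HasProjectiveDimensionLT X n] :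
    HomExact K X := by
  induction n generalizing X with
  | zero =>
    exact hP X (isZero_of_hasProjectiveDimensionLT_zero X).projective
  | succ n ih =>
    let S := ShortComplex.mk _ _ (Limits.kernel.condition (Projective.π X))
    have hS : S.ShortExact := {
      exact := S.exact_of_f_is_kernel (Limits.kernelIsKernel _) }
    cases n with
    | zero => exact hP X (projective_iff_hasProjectiveDimensionLT_one.2 ‹_›)
    | succ n =>
      have hπ : Projective S.X₂ := Projective.projective_over X
      have := (hS.hasProjectiveDimensionLT_X₃_iff n hπ).1 ‹_›
      exact right hS hK (ih S.X₁) (hP _ hπ)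

end HomExact

theorem acyclic_of_homExact_injective [EnoughInjectives C]
    (h : ∀ J : C, Injective J → HomExact K J) : K.Acyclic := by
  refine acyclic_iff_exact_sc'.2 fun i j k hij hjk => ?_
  rw [ShortComplex.exact_iff_kernel_ι_comp_cokernel_π_zero]
  let π := Limits.cokernel.π (K.d i j)
  obtain ⟨t, ht⟩ := h _ inferInstance hij hjk (π ≫ Injective.ι _) (by simp [π])
  have hι : Limits.kernel.ι (K.d j k) ≫ π ≫ Injective.ι _ = 0 := by simp [← ht]
  exact Limits.zero_of_comp_mono (Injective.ι _) ((Category.assoc _ _ _).trans hι)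

end HomExact

section CMFree

variable {C : Type u} [Category.{v} C] [Abelian C]

variable (C) in
/-- The analogue of `StronglyLeftCMFree` for an arbitrary abelian category; for a category of
modules the two notions agree by definition. -/
def StronglyCMFree : Prop := ∀ G : C, IsGorensteinProjective G → Projective G

theorem isCompleteProjectiveResolution_iff {K : CochainComplex C ℤ} :
    IsCompleteProjectiveResolution K ↔ (∀ i, Projective (K.X i)) ∧ K.Acyclic ∧
      ∀ P : C, Projective P → HomExact K P := by
  constructor
  · intro h
    refine ⟨h.projective, h.acyclic, fun P hP i j k hij hjk => ?_⟩
    subst hij hjk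
    exact h.hom_exact P hP i
  · rintro ⟨hK, hac, hP⟩
    exact ⟨hK, hac, fun P hP' i => hP P hP' rfl rfl⟩

/-- The complex `K` with the term `Kⁱ⁺ⁿ` in degree `i`; unlike in `K⟦n⟧`, the differentials keep
their signs. -/
def translate (n : ℤ) (K : CochainComplex C ℤ) : CochainComplex C ℤ where
  X i := K.X (i + n)
  d i j := K.d (i + n) (j + n)
  shape i j h := K.shape _ _ fun h' => h (by simp only [ComplexShape.up_Rel] at h' ⊢; omega)

theorem IsCompleteProjectiveResolution.translate {K : CochainComplex C ℤ}
    (h : IsCompleteProjectiveResolution K) (n : ℤ) :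
    IsCompleteProjectiveResolution (translate n K) := by
  obtain ⟨hK, hac, hP⟩ := isCompleteProjectiveResolution_iff.1 h
  refine isCompleteProjectiveResolution_iff.2 ⟨fun i => hK _, acyclic_iff_exact_sc'.2 ?_, ?_⟩
  · intro i j k hij hjk
    exact acyclic_iff_exact_sc'.1 hac (i := i + n) (by omega) (by omega)
  · intro P hP' i j k hij hjk
    exact hP P hP' (i := i + n) (by omega) (by omega)

theorem StronglyCMFree.projective_image (h : StronglyCMFree C) {K : CochainComplex C ℤ}
    (hK : IsCompleteProjectiveResolution K) {i j : ℤ} (hij : i + 1 = j) :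
    Projective (Limits.image (K.d i j)) := by
  obtain ⟨n, rfl⟩ : ∃ n, j = 0 + n := ⟨j, by omega⟩
  obtain rfl : i = -1 + n := by omega
  exact h _ ⟨_, hK.translate n, ⟨Iso.refl _⟩⟩

theorem StronglyCMFree.homExact (h : StronglyCMFree C) {K : CochainComplex C ℤ}
    (hK : IsCompleteProjectiveResolution K) (W : C) : HomExact K W := by
  intro i j k hij hjk f hf
  have := h.projective_image hK (i := k) rfl
  have := hK.projective j
  have := hK.projective k
  have hex := acyclic_iff_exact_sc'.1 hK.acyclic
  let p := Limits.factorThruImage (K.d k (k + 1))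
  have hp : K.d j k ≫ p = 0 := Limits.comp_factorThruImage_eq_zero (K.d_comp_d _ _ _)
  let s := Projective.factorThru (𝟙 _) p
  have hs : s ≫ p = 𝟙 _ := Projective.factorThru_comp _ _
  have hpd : p ≫ Limits.image.ι _ = K.d k (k + 1) := Limits.image.fac _
  obtain ⟨c, hc⟩ : ∃ c : K.X k ⟶ K.X j, c ≫ K.d j k = 𝟙 _ - p ≫ s :=
    ⟨_, (hex hjk rfl).liftFromProjective_comp _ (by
      change (𝟙 _ - p ≫ s) ≫ K.d k (k + 1) = 0
      simp [← hpd, reassoc_of% hs])⟩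
  obtain ⟨c', hc'⟩ : ∃ c' : K.X j ⟶ K.X i, c' ≫ K.d i j = 𝟙 _ - K.d j k ≫ c :=
    ⟨_, (hex hij hjk).liftFromProjective_comp _ (by
      change (𝟙 _ - K.d j k ≫ c) ≫ K.d j k = 0
      simp [hc, reassoc_of% hp])⟩
  have hf' : (𝟙 _ - K.d j k ≫ c) ≫ f = 0 := by rw [← hc', Category.assoc, hf, Limits.comp_zero]
  rw [Preadditive.sub_comp, Category.id_comp, Category.assoc, sub_eq_zero] at hf'
  exact ⟨c ≫ f, hf'.symm⟩

theorem stronglyCMFree_iff :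
    StronglyCMFree C ↔ ∀ K : CochainComplex C ℤ, IsCompleteProjectiveResolution K →
      ∀ W : C, HomExact K W := by
  refine ⟨fun h K hK => h.homExact hK, ?_⟩
  rintro h G ⟨K, hK, ⟨e⟩⟩
  have := hK.projective 0
  let p := Limits.factorThruImage (K.d (-1) 0)
  have hp : K.d (-2) (-1) ≫ p = 0 := Limits.comp_factorThruImage_eq_zero (K.d_comp_d _ _ _)
  obtain ⟨r, hr⟩ := h K hK _ (i := -2) (k := 0) (by norm_num) (by norm_num) p hp
  have hι : Limits.image.ι (K.d (-1) 0) ≫ r = 𝟙 _ := by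
    rw [← cancel_epi p, Limits.image.fac_assoc, hr, Category.comp_id]
  exact Projective.of_iso e.symm (Retract.projective ⟨_, r, hι⟩)

end CMFree

section Adjunction

variable {C : Type u} [Category.{v} C] [Abelian C] {D : Type*} [Category* D] [Abelian D]
  {F : C ⥤ D} {G : D ⥤ C} (adj : F ⊣ G)
include adj

theorem homExact_mapHomologicalComplex_iff [F.Additive] [G.Additive] {K : CochainComplex C ℤ}
    {W : D} : HomExact ((F.mapHomologicalComplex _).obj K) W ↔ HomExact K (G.obj W) := by
  refine forall₅_congr fun i j k _ _ => (adj.homEquiv (K.X j) W).forall_congr fun f =>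
    imp_congr ?_ ((adj.homEquiv (K.X k) W).exists_congr fun g => ?_)
  · change F.map (K.d i j) ≫ f = 0 ↔ _
    rw [← adj.homEquiv_naturality_left, ← adj.homAddEquiv_zero, (adj.homEquiv _ _).apply_eq_iff_eq]
  · change F.map (K.d j k) ≫ g = f ↔ _
    rw [← adj.homEquiv_naturality_left, (adj.homEquiv _ _).apply_eq_iff_eq]

/-- `F K` is a complete projective resolution in the CM-free category `D`. -/
theorem StronglyCMFree.homExact_of_adjunction (hD : StronglyCMFree D) [EnoughInjectives D]
    [G.Additive] [G.PreservesEpimorphisms] {K : CochainComplex C ℤ}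
    (hK : ∀ i, Projective (K.X i)) (hP : ∀ P : D, Projective P → HomExact K (G.obj P))
    (hJ : ∀ J : D, Injective J → HomExact K (G.obj J)) (W : D) : HomExact K (G.obj W) := by
  have := adj.left_adjoint_additive
  let FK := (F.mapHomologicalComplex _).obj K
  have hFK (W) : HomExact FK W ↔ HomExact K (G.obj W) := homExact_mapHomologicalComplex_iff adj
  refine (hFK W).1 (hD.homExact (isCompleteProjectiveResolution_iff.2 ⟨fun i => ?_, ?_, ?_⟩) W)
  · exact adj.map_projective _ (hK i)
  · exact acyclic_of_homExact_injective fun J hJ' => (hFK J).2 (hJ J hJ')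
  · exact fun P hP' => (hFK P).2 (hP P hP')

end Adjunction

section RestrictScalars

theorem isRightAdjoint_of_preservesLimits {R S : Type u} [Ring R] [Ring S]
    (G : ModuleCat.{u} R ⥤ ModuleCat.{u} S) [Limits.PreservesLimits G] : G.IsRightAdjoint :=
  isRightAdjoint_of_preservesLimits_of_isCoseparating (isCoseparator_coseparator (ModuleCat R)) G

instance {R S : Type u} [Ring R] [Ring S] (σ : R →+* S) :
    (ModuleCat.restrictScalars.{u} σ).IsRightAdjoint :=
  have : Limits.PreservesLimits (ModuleCat.restrictScalars.{u} σ) := ⟨⟨inferInstance⟩⟩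
  isRightAdjoint_of_preservesLimits _

end RestrictScalars

section FreeModules

variable {R : Type u} [Ring R]

theorem exact_finsupp_mapRange (I : Type*) {X Y Z : Type*} [AddCommGroup X] [Module R X]
    [AddCommGroup Y] [Module R Y] [AddCommGroup Z] [Module R Z] {f : X →ₗ[R] Y} {g : Y →ₗ[R] Z}
    (h : Function.Exact f g) (hf : Function.Injective f) :
    Function.Exact (Finsupp.mapRange.linearMap (α := I) f) (Finsupp.mapRange.linearMap g) := by
  rw [LinearMap.exact_iff, Finsupp.ker_mapRange,
    Finsupp.range_mapRange_linearMap f (LinearMap.ker_eq_bot.2 hf), h.linearMap_ker_eq]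

theorem projective_finsupp (I X : Type*) [AddCommGroup X] [Module R X] [Module.Projective R X] :
    Module.Projective R (I →₀ X) := by
  classical exact .of_equiv (finsuppLequivDFinsupp R (ι := I) (M := X)).symm

theorem shortExact_finsupp (I : Type u) {S : ShortComplex (ModuleCat.{u} R)} (hS : S.ShortExact) :
    (ModuleCat.shortComplexOfCompEqZero (Finsupp.mapRange.linearMap (α := I) S.f.hom)
      (Finsupp.mapRange.linearMap S.g.hom) (exact_finsupp_mapRange I
        ((ShortComplex.ShortExact.moduleCat_exact_iff_function_exact S).1 hS.exact)
        hS.moduleCat_injective_f).linearMap_comp_eq_zero).ShortExact :=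
  ModuleCat.shortComplex_shortExact _
    (exact_finsupp_mapRange I
      ((ShortComplex.ShortExact.moduleCat_exact_iff_function_exact S).1 hS.exact)
      hS.moduleCat_injective_f)
    (Finsupp.mapRange_injective _ (map_zero S.f.hom) hS.moduleCat_injective_f)
    (Finsupp.mapRange_surjective _ (map_zero S.g.hom) hS.moduleCat_surjective_g)

theorem hasProjectiveDimensionLT_finsupp (I : Type u) (n : ℕ) (X : ModuleCat.{u} R)
    [HasProjectiveDimensionLT X (n + 1)] :
    HasProjectiveDimensionLT (ModuleCat.of R (I →₀ X)) (n + 1) := by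
  induction n generalizing X with
  | zero =>
    have := (IsProjective.iff_projective X).2 (projective_iff_hasProjectiveDimensionLT_one.2 ‹_›)
    exact projective_iff_hasProjectiveDimensionLT_one.1
      ((IsProjective.iff_projective (I →₀ X)).1 (projective_finsupp I X))
  | succ n ih =>
    have hS := X.shortExact_projectiveShortComplex
    have : Module.Projective R X.projectiveShortComplex.X₂ := inferInstance
    have : HasProjectiveDimensionLT X.projectiveShortComplex.X₁ (n + 1) :=
      (hS.hasProjectiveDimensionLT_X₃_iff n ((IsProjective.iff_projective _).1 this)).1 ‹_›
    exact ((shortExact_finsupp I hS).hasProjectiveDimensionLT_X₃_iff n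
      ((IsProjective.iff_projective _).1 (projective_finsupp I X.projectiveShortComplex.X₂))).2
      (ih X.projectiveShortComplex.X₁)

theorem exists_retract_finsupp (P : ModuleCat.{u} R) [Projective P] :
    Nonempty (Retract P (ModuleCat.of R (P →₀ R))) := by
  have := (IsProjective.iff_projective P).2 ‹_›
  obtain ⟨s, hs⟩ := Module.Projective.out (R := R) (P := P)
  exact ⟨ModuleCat.ofHom s, ModuleCat.ofHom (Finsupp.linearCombination R id),
    ModuleCat.hom_ext (LinearMap.ext hs)⟩

end FreeModules

section Dual

theorem exists_extend_addMonoidHom {D : Type u} [AddCommGroup D] [Injective (AddCommGrpCat.of D)]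
    {A B : Type u} [AddCommGroup A] [AddCommGroup B] {f : A →+ B} (hf : Function.Injective f)
    (h : A →+ D) : ∃ g : B →+ D, ∀ a, g (f a) = h a := by
  have : Mono (AddCommGrpCat.ofHom f) := (AddCommGrpCat.mono_iff_injective _).2 hf
  exact ⟨(Injective.factorThru (AddCommGrpCat.ofHom h) (AddCommGrpCat.ofHom f)).hom,
    ConcreteCategory.congr_hom
      (Injective.comp_factorThru (AddCommGrpCat.ofHom h) (AddCommGrpCat.ofHom f))⟩

/-- The character group `Hom_ℤ(U, D)` of a right `R`-module `U` with values in an abelian group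
`D`, regarded as a left `R`-module. -/
def Dual (_R U D : Type u) [AddCommGroup U] [AddCommGroup D] : Type u := U →+ D

namespace Dual

variable {R U U' D : Type u} [AddCommGroup D] [AddCommGroup U] [AddCommGroup U']

instance : AddCommGroup (Dual R U D) := inferInstanceAs (AddCommGroup (U →+ D))

instance : FunLike (Dual R U D) U D := inferInstanceAs (FunLike (U →+ D) U D)

instance : AddMonoidHomClass (Dual R U D) U D :=
  inferInstanceAs (AddMonoidHomClass (U →+ D) U D)

@[ext] theorem ext {h h' : Dual R U D} (H : ∀ u, h u = h' u) : h = h' := DFunLike.ext _ _ H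

@[simp] theorem add_apply (h h' : Dual R U D) (u : U) : (h + h') u = h u + h' u := rfl
@[simp] theorem zero_apply (u : U) : (0 : Dual R U D) u = 0 := rfl

variable [Ring R] [Module Rᵐᵒᵖ U] [Module Rᵐᵒᵖ U']

instance : Module R (Dual R U D) where
  smul r h := AddMonoidHom.comp h (DistribSMul.toAddMonoidHom U (MulOpposite.op r))
  one_smul h := ext fun u => congrArg h (one_smul Rᵐᵒᵖ u)
  mul_smul r s h := ext fun u => congrArg h (mul_smul (MulOpposite.op s) (MulOpposite.op r) u)
  smul_zero _ := rfl
  smul_add _ _ _ := rfl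
  add_smul r _ h := ext fun u =>
    (congrArg h (add_smul (MulOpposite.op r) _ u)).trans (map_add h _ _)
  zero_smul h := ext fun u => (congrArg h (zero_smul Rᵐᵒᵖ u)).trans (map_zero h)

@[simp] theorem smul_apply (r : R) (h : Dual R U D) (u : U) :
    (r • h) u = h (MulOpposite.op r • u) := rfl

variable (D) in
/-- Precomposition with a homomorphism of right modules. -/
def map (f : U →ₗ[Rᵐᵒᵖ] U') : Dual R U' D →ₗ[R] Dual R U D where
  toFun h := AddMonoidHom.comp h f.toAddMonoidHom
  map_add' _ _ := rfl
  map_smul' _ h := ext fun u => congrArg h (map_smul f _ u).symm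

theorem map_surjective [Injective (AddCommGrpCat.of D)] {f : U →ₗ[Rᵐᵒᵖ] U'}
    (hf : Function.Injective f) : Function.Surjective (map D f) := fun h =>
  (exists_extend_addMonoidHom (f := f.toAddMonoidHom) hf h).imp fun _ => ext

theorem map_injective {g : U →ₗ[Rᵐᵒᵖ] U'} (hg : Function.Surjective g) :
    Function.Injective (map D g) := fun _ _ h =>
  ext fun u => by obtain ⟨u, rfl⟩ := hg u; exact DFunLike.congr_fun h u

theorem exact_map {g : U →ₗ[Rᵐᵒᵖ] U'} (hg : Function.Surjective g) :
    Function.Exact (map D g) (map (R := R) D (LinearMap.ker g).subtype) := by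
  intro h
  constructor
  · intro hh
    have hker : g.toAddMonoidHom.ker ≤ AddMonoidHom.ker h :=
      fun u hu => (DFunLike.congr_fun hh ⟨u, hu⟩ :)
    exact ⟨g.toAddMonoidHom.liftOfSurjective hg ⟨h, hker⟩,
      ext (g.toAddMonoidHom.liftOfRightInverse_comp_apply _ (Function.rightInverse_surjInv hg)
        ⟨h, hker⟩)⟩
  · rintro ⟨h, rfl⟩
    exact ext fun u => (congrArg h u.2).trans (map_zero h)

theorem shortExact [Injective (AddCommGrpCat.of D)] {g : U →ₗ[Rᵐᵒᵖ] U'}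
    (hg : Function.Surjective g) :
    (ModuleCat.shortComplexOfCompEqZero (map D g) (map (R := R) D (LinearMap.ker g).subtype)
      (exact_map hg).linearMap_comp_eq_zero).ShortExact :=
  ModuleCat.shortComplex_shortExact _ (exact_map hg) (map_injective hg)
    (map_surjective Subtype.val_injective)

section Coinduced

variable {N : Type u} [AddCommGroup N] [Module R N]

/-- The `R`-linear map to the coinduced module corresponding to an additive map `ψ : N → D`. -/
def coinduced (ψ : N →+ D) : N →ₗ[R] Dual R R D where
  toFun n := ψ.comp ((smulAddHom R N).flip n)
  map_add' n n' := ext fun r => (congrArg ψ (smul_add r n n')).trans (map_add ψ _ _)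
  map_smul' s n := ext fun r => congrArg ψ (mul_smul r s n).symm

instance injective_self [Injective (AddCommGrpCat.of D)] :
    Injective (ModuleCat.of R (Dual R R D)) := by
  refine (Module.injective_iff_injective_object R _).1 ⟨fun X Y _ _ _ _ i hi φ => ?_⟩
  obtain ⟨ψ, hψ⟩ := exists_extend_addMonoidHom (D := D) (f := i.toAddMonoidHom) hi
    { toFun x := φ x 1, map_zero' := by simp, map_add' := by simp }
  refine ⟨coinduced ψ, fun x => ext fun r => ?_⟩
  calc ψ (r • i x) = ψ (i (r • x)) := by rw [map_smul i]
    _ = φ (r • x) 1 := hψ _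
    _ = φ x r := by rw [map_smul, smul_apply, op_smul_eq_mul, one_mul]

end Coinduced

section Tensor

variable {N : Type u} [AddCommGroup N] [Module R N]

/-- The tensor-hom adjunction for a right module `U`. -/
def tensorHomEquiv : (BalancedTensor R U N →+ D) ≃ (N →ₗ[R] Dual R U D) where
  toFun θ :=
    { toFun n := (θ.comp (QuotientAddGroup.mk' _)).comp
        ((TensorProduct.mk ℤ U N).flip n).toAddMonoidHom
      map_add' n n' := ext fun u => (congrArg (θ.comp (QuotientAddGroup.mk' _))
        (TensorProduct.tmul_add u n n')).trans (map_add _ _ _)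
      map_smul' r n := ext fun u => by
        have h : (MulOpposite.op r • u) ⊗ₜ[ℤ] n - u ⊗ₜ[ℤ] (r • n) ∈ balancedRelations R U N :=
          AddSubgroup.subset_closure ⟨u, r, n, rfl⟩
        exact congrArg θ (QuotientAddGroup.eq_iff_sub_mem.2 h).symm }
  invFun φ := QuotientAddGroup.lift _
    (TensorProduct.liftAddHom (AddMonoidHom.flip (φ.toAddMonoidHom : N →+ (U →+ D)))
      fun r u n => by simp) (by
      refine (AddSubgroup.closure_le _).2 ?_
      rintro _ ⟨u, r, n, rfl⟩
      rw [SetLike.mem_coe, AddMonoidHom.mem_ker, map_sub, TensorProduct.liftAddHom_tmul,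
        TensorProduct.liftAddHom_tmul]
      change φ n (MulOpposite.op r • u) - φ (r • n) u = 0
      rw [map_smul φ, smul_apply, sub_self])
  left_inv θ := QuotientAddGroup.addMonoidHom_ext _
    (AddMonoidHom.toIntLinearMap_injective (TensorProduct.ext' fun _ _ => rfl))
  right_inv φ := rfl

theorem tensorHomEquiv_comp_balancedTensorMap {N' : Type u} [AddCommGroup N'] [Module R N']
    (θ : BalancedTensor R U N' →+ D) (f : N →ₗ[R] N') :
    tensorHomEquiv (θ.comp (balancedTensorMap R U f)) = tensorHomEquiv θ ∘ₗ f := by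
  ext n u
  rfl

theorem injective_of_isFlatRight [Injective (AddCommGrpCat.of D)] (hU : IsFlatRight R U) :
    Injective (ModuleCat.of R (Dual R U D)) := by
  refine (Module.injective_iff_injective_object R _).1 ⟨fun X Y _ _ _ _ i hi φ => ?_⟩
  obtain ⟨θ, hθ⟩ := exists_extend_addMonoidHom (hU X Y i hi) (tensorHomEquiv.symm φ)
  have h : tensorHomEquiv θ ∘ₗ i = φ := by
    rw [← tensorHomEquiv_comp_balancedTensorMap, ← Equiv.eq_symm_apply]
    exact AddMonoidHom.ext hθ
  exact ⟨tensorHomEquiv θ, LinearMap.congr_fun h⟩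

end Tensor

end Dual

theorem exists_retract_dual {R : Type u} [Ring R] (J : ModuleCat.{u} R) [Injective J] :
    ∃ (D : Type u) (_ : AddCommGroup D), Injective (AddCommGrpCat.of D) ∧
      Nonempty (Retract J (ModuleCat.of R (Dual R R D))) := by
  let A := AddCommGrpCat.of J
  let D := Injective.under A
  let f : J ⟶ ModuleCat.of R (Dual R R D) := ModuleCat.ofHom (Dual.coinduced (Injective.ι A).hom)
  have : Mono f := (ModuleCat.mono_iff_injective _).2 fun x y h => by
    have h1 : Injective.ι A ((1 : R) • x) = Injective.ι A ((1 : R) • y) := DFunLike.congr_fun h 1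
    rw [one_smul, one_smul] at h1
    exact (AddCommGrpCat.mono_iff_injective _).1 (Injective.ι_mono A) h1
  exact ⟨D, inferInstance, inferInstanceAs (Injective (Injective.under A)),
    ⟨⟨f, Injective.factorThru (𝟙 J) f, Injective.comp_factorThru _ _⟩⟩⟩

end Dual

section FiniteFlatDimension

variable {Γ : Type u} [Ring Γ] {K : CochainComplex (ModuleCat.{u} Γ) ℤ}
  (hK : ∀ i, Projective (K.X i)) (hac : K.Acyclic) (D : Type u) [AddCommGroup D]
  [Injective (AddCommGrpCat.of D)]
include hK hac

theorem homExact_dual_of_flatResolution (n : ℕ) {U : Type u} [AddCommGroup U] [Module Γᵐᵒᵖ U]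
    {F : ℕ → ModuleCat.{u} Γᵐᵒᵖ} {d : ∀ i, F (i + 1) →ₗ[Γᵐᵒᵖ] F i} {ε : F 0 →ₗ[Γᵐᵒᵖ] U}
    (hF : ∀ i, IsFlatRight Γ (F i)) (hn : ∀ i, n ≤ i → Subsingleton (F i))
    (hε : Function.Surjective ε) (hd₀ : Function.Exact (d 0) ε)
    (hd : ∀ i, Function.Exact (d (i + 1)) (d i)) :
    HomExact K (ModuleCat.of Γ (Dual Γ U D)) := by
  induction n generalizing U F with
  | zero =>
    have := hn 0 le_rfl
    have := hε.subsingleton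
    have : Subsingleton (Dual Γ U D) := inferInstanceAs (Subsingleton (U →+ D))
    have := (ModuleCat.isZero_of_subsingleton (ModuleCat.of Γ (Dual Γ U D))).injective
    exact .of_injective hac _
  | succ n ih =>
    have := Dual.injective_of_isFlatRight (D := D) (hF 0)
    have hker : ∀ x, d 0 x ∈ LinearMap.ker ε := hd₀.apply_apply_eq_zero
    refine HomExact.left (Dual.shortExact hε) hK (.of_injective hac _)
      (ih (F := fun i => F (i + 1)) (d := fun i => d (i + 1)) (ε := (d 0).codRestrict _ hker)
        (fun i => hF (i + 1)) (fun i hi => hn (i + 1) (by omega)) ?_ ?_ fun i => hd (i + 1))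
    · rintro ⟨x, hx⟩
      obtain ⟨y, rfl⟩ := (hd₀ x).1 hx
      exact ⟨y, rfl⟩
    · exact fun x => Subtype.ext_iff.trans (hd 0 x)

theorem homExact_dual {U : Type u} [AddCommGroup U] [Module Γᵐᵒᵖ U]
    (hU : HasFiniteFlatDimensionRight Γ U) : HomExact K (ModuleCat.of Γ (Dual Γ U D)) := by
  obtain ⟨n, F, d, ε, hF, hn, hε, hd₀, hd⟩ := hU
  exact homExact_dual_of_flatResolution hK hac D (n + 1) hF hn hε hd₀ hd

end FiniteFlatDimension

noncomputable section Corner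

variable {S T : Type u} [Ring S] [Ring T] (ι : S →ₙ+* T)

/-- For a ring homomorphism `ι : S → T` that need not preserve the unit, the part `ι(1) W` of a
`T`-module `W`, on which the idempotent `ι(1)` acts as the identity. It is an `S`-module. -/
def corner (W : Type u) [AddCommGroup W] [Module T W] : AddSubgroup W :=
  (Module.toAddMonoidEnd T W (ι 1)).eqLocus (AddMonoidHom.id W)

variable {ι} {W : Type u} [AddCommGroup W] [Module T W]

theorem map_smul_mem_corner (s : S) (w : W) : ι s • w ∈ corner ι W := by
  change ι 1 • ι s • w = ι s • w
  rw [smul_smul, ← map_mul, one_mul]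

theorem map_one_smul_of_mem_corner {w : W} (hw : w ∈ corner ι W) : ι 1 • w = w := hw

instance : Module S (corner ι W) where
  smul s w := ⟨ι s • w.1, map_smul_mem_corner s w.1⟩
  one_smul w := Subtype.ext w.2
  mul_smul s s' w := Subtype.ext ((congrArg (· • w.1) (map_mul ι s s')).trans (mul_smul _ _ _))
  smul_zero _ := Subtype.ext (smul_zero _)
  smul_add _ _ _ := Subtype.ext (smul_add _ _ _)
  add_smul s s' w := Subtype.ext ((congrArg (· • w.1) (map_add ι s s')).trans (add_smul _ _ _))
  zero_smul w := Subtype.ext ((congrArg (· • w.1) (map_zero ι)).trans (zero_smul _ _))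

@[simp] theorem coe_smul_corner (s : S) (w : corner ι W) :
    ((s • w : corner ι W) : W) = ι s • w.1 := rfl

variable (ι) in
/-- The functor `W ↦ ι(1) W`. -/
def cornerFunctor : ModuleCat.{u} T ⥤ ModuleCat.{u} S where
  obj W := ModuleCat.of S (corner ι W)
  map {W W'} f := ModuleCat.ofHom
    { toFun w := ⟨f w.1, (map_smul f.hom _ _).symm.trans (congrArg f w.2)⟩
      map_add' w w' := Subtype.ext (map_add f.hom _ _)
      map_smul' s w := Subtype.ext (map_smul f.hom _ _) }

instance : (cornerFunctor ι).Additive where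

instance : (cornerFunctor ι).PreservesEpimorphisms where
  preserves {W W'} f hf := by
    rw [ModuleCat.epi_iff_surjective] at hf ⊢
    rintro ⟨w', hw'⟩
    obtain ⟨w, rfl⟩ := hf w'
    exact ⟨⟨ι 1 • w, map_smul_mem_corner 1 w⟩, Subtype.ext ((map_smul f.hom _ _).trans hw')⟩

theorem map_one_mem_corner_of_linearMap (f : T ∙ ι 1 →ₗ[T] W) :
    f ⟨ι 1, Submodule.mem_span_singleton_self _⟩ ∈ corner ι W :=
  (map_smul f _ _).symm.trans
    (congrArg f (Subtype.ext ((map_mul ι 1 1).symm.trans (congrArg ι (one_mul 1)))))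

/-- `ι(1) W` is the group of `T`-linear maps to `W` from the left ideal `T ι(1)`. -/
def cornerFunctorForgetIso : cornerFunctor ι ⋙ forget _ ≅
    coyoneda.obj (.op (ModuleCat.of T (T ∙ ι 1))) :=
  NatIso.ofComponents (fun W => Equiv.toIso
    { toFun w := ModuleCat.ofHom ((LinearMap.toSpanSingleton T W w.1).comp (Submodule.subtype _))
      invFun f := ⟨_, map_one_mem_corner_of_linearMap (ModuleCat.Hom.hom f)⟩
      left_inv w := Subtype.ext w.2
      right_inv f := by
        refine ModuleCat.hom_ext (LinearMap.ext ?_)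
        rintro ⟨x, hx⟩
        obtain ⟨t, rfl⟩ := Submodule.mem_span_singleton.1 hx
        let f' := ModuleCat.Hom.hom f
        let e : T ∙ ι 1 := ⟨ι 1, Submodule.mem_span_singleton_self _⟩
        change (t • ι 1) • f' e = f' (t • e)
        rw [smul_assoc, map_smul,
          map_one_smul_of_mem_corner (map_one_mem_corner_of_linearMap f')] })
    fun f => by ext w; exact ModuleCat.hom_ext (LinearMap.ext fun x => (map_smul f.hom _ _).symm)

instance : (cornerFunctor ι).IsRightAdjoint :=
  have := Limits.preservesLimits_of_natIso (cornerFunctorForgetIso (ι := ι)).symm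
  have := Limits.preservesLimits_of_reflects_of_preserves (cornerFunctor ι) (forget (ModuleCat S))
  isRightAdjoint_of_preservesLimits _

section Retraction

variable {σ : T →+* S} (hσ : ∀ s, σ (ι s) = s)
include hσ

theorem map_smul_restrictScalars (V : ModuleCat.{u} S) (s : S)
    (v : (ModuleCat.restrictScalars σ).obj V) : ι s • v = (s • v : V) :=
  congrArg (· • (v : V)) (hσ s)

theorem mem_corner_restrictScalars (V : ModuleCat.{u} S) (v : (ModuleCat.restrictScalars σ).obj V) :
    v ∈ corner ι ((ModuleCat.restrictScalars σ).obj V) :=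
  (map_smul_restrictScalars hσ V 1 v).trans (one_smul S (v : V))

/-- If `σ : T → S` is a retraction of `ι`, then `ι(1) V = V` for every `S`-module `V`. -/
def cornerRestrictScalarsIso (V : ModuleCat.{u} S) :
    (cornerFunctor ι).obj ((ModuleCat.restrictScalars σ).obj V) ≅ V :=
  LinearEquiv.toModuleIso
    { toFun w := w.1
      invFun v := ⟨v, mem_corner_restrictScalars hσ V v⟩
      map_add' _ _ := rfl
      map_smul' s w := map_smul_restrictScalars hσ V s w.1
      left_inv _ := rfl
      right_inv _ := rfl }

/-- If `T ι(1) ⊆ ι(S)`, then `ι(1) W` is the largest submodule of `W` on which `T` acts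
through `σ`. -/
def restrictScalarsCornerAdj (h : ∀ t, t * ι 1 = ι (σ t)) :
    ModuleCat.restrictScalars.{u} σ ⊣ cornerFunctor ι :=
  Adjunction.mkOfHomEquiv
    { homEquiv V W :=
        { toFun f := ModuleCat.ofHom
            { toFun v := ⟨f v, (f.hom.map_smul (ι 1) v).symm.trans
                (congrArg f (mem_corner_restrictScalars hσ V v))⟩
              map_add' v v' := Subtype.ext (map_add f.hom v v')
              map_smul' s v := Subtype.ext
                ((congrArg f (map_smul_restrictScalars hσ V s v)).symm.trans
                  (f.hom.map_smul (ι s) v)) }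
          invFun g := ModuleCat.ofHom (X := (ModuleCat.restrictScalars σ).obj V)
            { toFun v := (g v).1
              map_add' v v' := congrArg Subtype.val (map_add g.hom v v')
              map_smul' t v := by
                refine (congrArg Subtype.val (map_smul g.hom (σ t) v)).trans ?_
                change ι (σ t) • (g v).1 = t • (g v).1
                rw [← h, mul_smul, map_one_smul_of_mem_corner (g v).2] } } }

/-- If `ι(1) T ⊆ ι(S)`, then `ι(1) W` is the largest quotient of `W` on which `T` acts
through `σ`. -/
def cornerRestrictScalarsAdj (h : ∀ t, ι 1 * t = ι (σ t)) :
    cornerFunctor ι ⊣ ModuleCat.restrictScalars.{u} σ :=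
  Adjunction.mkOfHomEquiv
    { homEquiv W V :=
        { toFun f := ModuleCat.ofHom (Y := (ModuleCat.restrictScalars σ).obj V)
            { toFun w := f ⟨ι 1 • w, map_smul_mem_corner 1 w⟩
              map_add' w w' :=
                (congrArg f (Subtype.ext (smul_add (ι 1) w w'))).trans (map_add f.hom _ _)
              map_smul' t w := (congrArg f (Subtype.ext (by
                change ι 1 • t • w = ι (σ t) • ι 1 • w
                rw [smul_smul, smul_smul, h, ← map_mul, mul_one]))).trans (map_smul f.hom (σ t) _) }
          invFun g := ModuleCat.ofHom
            { toFun w := g w.1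
              map_add' w w' := map_add g.hom _ _
              map_smul' s w :=
                (map_smul g.hom _ _).trans (map_smul_restrictScalars hσ V s (g w.1)) }
          left_inv f := ModuleCat.hom_ext (LinearMap.ext fun w => congrArg f (Subtype.ext w.2))
          right_inv g := ModuleCat.hom_ext (LinearMap.ext fun w =>
            (map_smul g.hom _ _).trans (mem_corner_restrictScalars hσ V (g w))) } }

end Retraction

end Corner

noncomputable section

namespace UpperTriangular

variable {Λ M Γ : Type u} [Ring Λ] [Ring Γ] [AddCommGroup M] [Module Λ M] [Module Γᵐᵒᵖ M]
  [SMulCommClass Λ Γᵐᵒᵖ M]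

variable (Λ M Γ)

/-- The projection of the triangular matrix ring onto `Λ`. -/
def aHom : UpperTriangular Λ M Γ →+* Λ where
  toFun := a
  map_one' := rfl
  map_mul' _ _ := rfl
  map_zero' := rfl
  map_add' _ _ := rfl

/-- The projection of the triangular matrix ring onto `Γ`. -/
def bHom : UpperTriangular Λ M Γ →+* Γ where
  toFun := b
  map_one' := rfl
  map_mul' _ _ := rfl
  map_zero' := rfl
  map_add' _ _ := rfl

/-- The inclusion of `Λ` into the triangular matrix ring as the upper left corner. -/
def aIncl : Λ →ₙ+* UpperTriangular Λ M Γ where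
  toFun x := ⟨x, 0, 0⟩
  map_mul' _ _ := by ext <;> simp
  map_zero' := rfl
  map_add' _ _ := by ext <;> simp

/-- The inclusion of `Γ` into the triangular matrix ring as the lower right corner. -/
def bIncl : Γ →ₙ+* UpperTriangular Λ M Γ where
  toFun x := ⟨0, 0, x⟩
  map_mul' _ _ := by ext <;> simp
  map_zero' := rfl
  map_add' _ _ := by ext <;> simp

@[simp] theorem aHom_apply (t : UpperTriangular Λ M Γ) : aHom Λ M Γ t = t.a := rfl
@[simp] theorem bHom_apply (t : UpperTriangular Λ M Γ) : bHom Λ M Γ t = t.b := rfl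
@[simp] theorem aIncl_apply (x : Λ) : aIncl Λ M Γ x = ⟨x, 0, 0⟩ := rfl
@[simp] theorem bIncl_apply (x : Γ) : bIncl Λ M Γ x = ⟨0, 0, x⟩ := rfl

/-- The adjunction expressing that `aIncl 1 • W` is the largest submodule of a module `W` over the
triangular matrix ring that is a `Λ`-module. -/
def aAdj : ModuleCat.restrictScalars.{u} (aHom Λ M Γ) ⊣ cornerFunctor (aIncl Λ M Γ) :=
  restrictScalarsCornerAdj (fun _ => rfl) fun t => by ext <;> simp

/-- The adjunction expressing that `bIncl 1 • W` is the largest quotient of a module `W` over the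
triangular matrix ring that is a `Γ`-module. -/
def bAdj : cornerFunctor (bIncl Λ M Γ) ⊣ ModuleCat.restrictScalars.{u} (bHom Λ M Γ) :=
  cornerRestrictScalarsAdj (fun _ => rfl) fun t => by ext <;> simp

variable {Λ M Γ}

theorem aIncl_one_add_bIncl_one : aIncl Λ M Γ 1 + bIncl Λ M Γ 1 = 1 := by
  ext <;> simp

theorem bIncl_one_mul_aIncl_one : bIncl Λ M Γ 1 * aIncl Λ M Γ 1 = 0 := by
  ext <;> simp

/-- A module over the triangular matrix ring is an extension of a `Γ`-module by a `Λ`-module. -/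
def triangle (W : ModuleCat.{u} (UpperTriangular Λ M Γ)) :
    ShortComplex (ModuleCat.{u} (UpperTriangular Λ M Γ)) where
  f := (aAdj Λ M Γ).counit.app W
  g := (bAdj Λ M Γ).unit.app W
  zero := by
    refine ModuleCat.hom_ext (LinearMap.ext fun w => Subtype.ext ?_)
    change bIncl Λ M Γ 1 • w.1 = 0
    rw [← map_one_smul_of_mem_corner w.2, smul_smul, bIncl_one_mul_aIncl_one, zero_smul]

theorem triangle_shortExact (W : ModuleCat.{u} (UpperTriangular Λ M Γ)) :
    (triangle W).ShortExact where
  exact := (ShortComplex.moduleCat_exact_iff _).2 fun w hw => by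
    have hw' : bIncl Λ M Γ 1 • w = 0 := congrArg Subtype.val hw
    have hw'' : aIncl Λ M Γ 1 • w = w := by
      rw [← add_zero (aIncl Λ M Γ 1 • w), ← hw', ← add_smul, aIncl_one_add_bIncl_one, one_smul]
    exact ⟨⟨w, hw''⟩, rfl⟩
  mono_f := (ModuleCat.mono_iff_injective _).2 Subtype.val_injective
  epi_g := (ModuleCat.epi_iff_surjective _).2 fun w => ⟨w.1, Subtype.ext w.2⟩

/-- The additive map sending a triangular matrix to its upper right entry. -/
def mHom : UpperTriangular Λ M Γ →+ M where
  toFun := m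
  map_zero' := rfl
  map_add' _ _ := rfl

/-- The additive inclusion of `M` into the triangular matrix ring as the upper right corner. -/
def mIncl : M →+ UpperTriangular Λ M Γ where
  toFun y := ⟨0, y, 0⟩
  map_zero' := rfl
  map_add' _ _ := by ext <;> simp

@[simp] theorem mIncl_apply (y : M) : mIncl y = (⟨0, y, 0⟩ : UpperTriangular Λ M Γ) := rfl

/-- The first row of the triangular matrix ring is `Λ ⊕ M` as a left `Λ`-module. -/
def cornerFinsuppEquiv (I : Type u) :
    corner (aIncl Λ M Γ) (I →₀ UpperTriangular Λ M Γ) ≃ₗ[Λ] (I →₀ Λ) × (I →₀ M) where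
  toFun w := (w.1.mapRange a rfl, w.1.mapRange m rfl)
  map_add' w w' := by ext <;> simp
  map_smul' x w := by ext <;> simp
  invFun p := ⟨p.1.mapRange (aIncl Λ M Γ) rfl + p.2.mapRange mIncl rfl, by
    refine Finsupp.ext fun i => ?_
    change aIncl Λ M Γ 1 * (aIncl Λ M Γ (p.1 i) + mIncl (p.2 i)) =
      aIncl Λ M Γ (p.1 i) + mIncl (p.2 i)
    ext <;> simp⟩
  left_inv w := by
    refine Subtype.ext (Finsupp.ext fun i => ?_)
    have hb : 0 = (w.1 i).b := by
      simpa using congrArg b (DFunLike.congr_fun (map_one_smul_of_mem_corner w.2) i)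
    change aIncl Λ M Γ (w.1 i).a + mIncl (w.1 i).m = w.1 i
    ext <;> simp [hb]
  right_inv p := by
    refine Prod.ext (Finsupp.ext fun i => ?_) (Finsupp.ext fun i => ?_)
    · exact add_zero (p.1 i)
    · exact zero_add (p.2 i)

/-- The last column of the triangular matrix ring is `M ⊕ Γ` as a right `Γ`-module. -/
def cornerDualEquiv (D : Type u) [AddCommGroup D] :
    corner (bIncl Λ M Γ) (Dual (UpperTriangular Λ M Γ) (UpperTriangular Λ M Γ) D) ≃ₗ[Γ]
      Dual Γ M D × Dual Γ Γ D where
  toFun h := (AddMonoidHom.comp h.1 mIncl, AddMonoidHom.comp h.1 (bIncl Λ M Γ).toAddMonoidHom)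
  map_add' _ _ := rfl
  map_smul' x h := by
    refine Prod.ext (Dual.ext fun y => congrArg h.1 ?_) (Dual.ext fun z => congrArg h.1 ?_)
    · change mIncl y * bIncl Λ M Γ x = mIncl (MulOpposite.op x • y)
      ext <;> simp
    · exact (map_mul (bIncl Λ M Γ) z x).symm
  invFun p := ⟨AddMonoidHom.comp p.1 mHom + AddMonoidHom.comp p.2 (bHom Λ M Γ).toAddMonoidHom, by
    refine Dual.ext fun t => ?_
    change p.1 (t * bIncl Λ M Γ 1).m + p.2 (t * bIncl Λ M Γ 1).b = p.1 t.m + p.2 t.b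
    simp⟩
  left_inv h := by
    refine Subtype.ext (Dual.ext fun t => ?_)
    calc h.1 (mIncl t.m) + h.1 (bIncl Λ M Γ t.b) = h.1 (t * bIncl Λ M Γ 1) := by
          rw [← map_add]
          congr 1
          ext <;> simp
      _ = h.1 t := DFunLike.congr_fun (map_one_smul_of_mem_corner h.2) t
  right_inv p := by
    refine Prod.ext (Dual.ext fun y => ?_) (Dual.ext fun z => ?_)
    · exact (congrArg (p.1 y + ·) (map_zero p.2)).trans (add_zero _)
    · exact (congrArg (· + p.2 z) (map_zero p.1)).trans (zero_add _)

theorem homExact_aCorner_projective (hM : HasFiniteProjectiveDimension Λ M)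
    {K : CochainComplex (ModuleCat.{u} Λ) ℤ} (hK : ∀ i, Projective (K.X i))
    (hP : ∀ P, Projective P → HomExact K P)
    (P : ModuleCat.{u} (UpperTriangular Λ M Γ)) [Projective P] :
    HomExact K ((cornerFunctor (aIncl Λ M Γ)).obj P) := by
  obtain ⟨n, hn⟩ := hM
  have := hasProjectiveDimensionLT_finsupp P n (ModuleCat.of Λ M)
  have hΛ : Projective (ModuleCat.of Λ (P →₀ Λ)) :=
    (IsProjective.iff_projective _).1 (projective_finsupp P Λ)
  have hPM : HomExact K (ModuleCat.of Λ (P →₀ M)) := .of_hasProjectiveDimensionLT hK hP (n + 1) _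
  obtain ⟨r⟩ := exists_retract_finsupp P
  have e : (cornerFunctor (aIncl Λ M Γ)).obj (ModuleCat.of _ (P →₀ UpperTriangular Λ M Γ)) ≅
      ModuleCat.of Λ (P →₀ Λ) ⊞ ModuleCat.of Λ (P →₀ M) :=
    (cornerFinsuppEquiv P).toModuleIso ≪≫ (ModuleCat.biprodIsoProd _ _).symm
  exact ((hP _ hΛ).biprod hPM).of_retract ((r.map (cornerFunctor _)).trans e.retract)

instance (P : ModuleCat.{u} Λ) [Projective P] :
    Projective ((ModuleCat.restrictScalars (aHom Λ M Γ)).obj P) :=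
  (aAdj Λ M Γ).map_projective P inferInstance

instance (J : ModuleCat.{u} (UpperTriangular Λ M Γ)) [Injective J] :
    Injective ((cornerFunctor (aIncl Λ M Γ)).obj J) :=
  (aAdj Λ M Γ).map_injective J inferInstance

instance (P : ModuleCat.{u} (UpperTriangular Λ M Γ)) [Projective P] :
    Projective ((cornerFunctor (bIncl Λ M Γ)).obj P) :=
  (bAdj Λ M Γ).map_projective P inferInstance

instance (J : ModuleCat.{u} Γ) [Injective J] :
    Injective ((ModuleCat.restrictScalars (bHom Λ M Γ)).obj J) :=
  (bAdj Λ M Γ).map_injective J inferInstance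

theorem homExact_bCorner_injective (hM : HasFiniteFlatDimensionRight Γ M)
    {K : CochainComplex (ModuleCat.{u} Γ) ℤ} (hK : ∀ i, Projective (K.X i)) (hac : K.Acyclic)
    (J : ModuleCat.{u} (UpperTriangular Λ M Γ)) [Injective J] :
    HomExact K ((cornerFunctor (bIncl Λ M Γ)).obj J) := by
  obtain ⟨D, _, _, ⟨r⟩⟩ := exists_retract_dual J
  have e : (cornerFunctor (bIncl Λ M Γ)).obj (ModuleCat.of _ (Dual _ _ D)) ≅
      ModuleCat.of Γ (Dual Γ M D) ⊞ ModuleCat.of Γ (Dual Γ Γ D) :=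
    (cornerDualEquiv D).toModuleIso ≪≫
      (ModuleCat.biprodIsoProd (ModuleCat.of Γ (Dual Γ M D)) (ModuleCat.of Γ (Dual Γ Γ D))).symm
  have h : HomExact K (ModuleCat.of Γ (Dual Γ M D) ⊞ ModuleCat.of Γ (Dual Γ Γ D)) :=
    (homExact_dual hK hac D hM).biprod (.of_injective hac _)
  exact h.of_retract ((r.map (cornerFunctor _)).trans e.retract)

theorem stronglyCMFree_left (hM : HasFiniteProjectiveDimension Λ M)
    (hT : StronglyCMFree (ModuleCat.{u} (UpperTriangular Λ M Γ))) :
    StronglyCMFree (ModuleCat.{u} Λ) := by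
  refine stronglyCMFree_iff.2 fun K hK W => ?_
  obtain ⟨hp, hac, hP⟩ := isCompleteProjectiveResolution_iff.1 hK
  have h := hT.homExact_of_adjunction (.ofIsRightAdjoint (cornerFunctor (aIncl Λ M Γ))) hp
    (fun P _ => homExact_aCorner_projective hM hp hP P) (fun J _ => .of_injective hac _)
    ((ModuleCat.restrictScalars (aHom Λ M Γ)).obj W)
  exact h.of_retract (cornerRestrictScalarsIso (fun _ => rfl) W).symm.retract

theorem stronglyCMFree_right (hM : HasFiniteFlatDimensionRight Γ M)
    (hT : StronglyCMFree (ModuleCat.{u} (UpperTriangular Λ M Γ))) :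
    StronglyCMFree (ModuleCat.{u} Γ) := by
  refine stronglyCMFree_iff.2 fun K hK W => ?_
  obtain ⟨hp, hac, hP⟩ := isCompleteProjectiveResolution_iff.1 hK
  have h := hT.homExact_of_adjunction (.ofIsRightAdjoint (cornerFunctor (bIncl Λ M Γ))) hp
    (fun P _ => hP _ inferInstance) (fun J _ => homExact_bCorner_injective hM hp hac J)
    ((ModuleCat.restrictScalars (bHom Λ M Γ)).obj W)
  exact h.of_retract (cornerRestrictScalarsIso (fun _ => rfl) W).symm.retract

section Extension

variable {K : CochainComplex (ModuleCat.{u} (UpperTriangular Λ M Γ)) ℤ}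

theorem homExact_restrict_aCorner_projective (hM : HasFiniteProjectiveDimension Λ M)
    (hK : IsCompleteProjectiveResolution K) (P : ModuleCat.{u} (UpperTriangular Λ M Γ))
    [Projective P] :
    HomExact K ((ModuleCat.restrictScalars (aHom Λ M Γ)).obj
      ((cornerFunctor (aIncl Λ M Γ)).obj P)) := by
  obtain ⟨hp, -, hP⟩ := isCompleteProjectiveResolution_iff.1 hK
  let adj := Adjunction.ofIsRightAdjoint (ModuleCat.restrictScalars.{u} (aHom Λ M Γ))
  have := adj.left_adjoint_additive
  rw [← homExact_mapHomologicalComplex_iff adj]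
  refine homExact_aCorner_projective hM (fun i => adj.map_projective _ (hp i)) (fun Q _ => ?_) P
  exact (homExact_mapHomologicalComplex_iff adj).2 (hP _ inferInstance)

theorem homExact_restrict_right (hM : HasFiniteProjectiveDimension Λ M)
    (hΓ : StronglyCMFree (ModuleCat.{u} Γ)) (hK : IsCompleteProjectiveResolution K)
    (W : ModuleCat.{u} Γ) : HomExact K ((ModuleCat.restrictScalars (bHom Λ M Γ)).obj W) := by
  obtain ⟨hp, hac, hP⟩ := isCompleteProjectiveResolution_iff.1 hK
  refine hΓ.homExact_of_adjunction (.ofIsRightAdjoint _) hp (fun Q _ => ?_)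
    (fun J _ => .of_injective hac _) W
  let q := ModuleCat.restrictScalars.{u} (bHom Λ M Γ)
  let P := Projective.over (q.obj Q)
  have h : HomExact K (q.obj ((cornerFunctor (bIncl Λ M Γ)).obj P)) :=
    HomExact.right (triangle_shortExact P) hp (homExact_restrict_aCorner_projective hM hK P)
      (hP P inferInstance)
  let e := cornerRestrictScalarsIso (σ := bHom Λ M Γ) (ι := bIncl Λ M Γ) (fun _ => rfl) Q
  let p := (cornerFunctor (bIncl Λ M Γ)).map (Projective.π (q.obj Q)) ≫ e.hom
  have r : Retract Q ((cornerFunctor (bIncl Λ M Γ)).obj P) :=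
    ⟨Projective.factorThru (𝟙 Q) p, p, Projective.factorThru_comp _ _⟩
  exact h.of_retract (r.map q)

theorem homExact_restrict_left (hM : HasFiniteProjectiveDimension Λ M)
    (hΛ : StronglyCMFree (ModuleCat.{u} Λ)) (hΓ : StronglyCMFree (ModuleCat.{u} Γ))
    (hK : IsCompleteProjectiveResolution K)
    (W : ModuleCat.{u} Λ) : HomExact K ((ModuleCat.restrictScalars (aHom Λ M Γ)).obj W) := by
  obtain ⟨hp, hac, hP⟩ := isCompleteProjectiveResolution_iff.1 hK
  refine hΛ.homExact_of_adjunction (.ofIsRightAdjoint _) hp (fun P _ => hP _ inferInstance)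
    (fun J _ => ?_) W
  let q := ModuleCat.restrictScalars.{u} (aHom Λ M Γ)
  let J' := Injective.under (q.obj J)
  have h : HomExact K (q.obj ((cornerFunctor (aIncl Λ M Γ)).obj J')) :=
    HomExact.left (triangle_shortExact J') hp (.of_injective hac J')
      (homExact_restrict_right hM hΓ hK _)
  let e := cornerRestrictScalarsIso (σ := aHom Λ M Γ) (ι := aIncl Λ M Γ) (fun _ => rfl) J
  let j := e.inv ≫ (cornerFunctor (aIncl Λ M Γ)).map (Injective.ι (q.obj J))
  have r : Retract J ((cornerFunctor (aIncl Λ M Γ)).obj J') :=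
    ⟨j, Injective.factorThru (𝟙 J) j, Injective.comp_factorThru _ _⟩
  exact h.of_retract (r.map q)

end Extension

theorem stronglyCMFree (hM : HasFiniteProjectiveDimension Λ M)
    (hΛ : StronglyCMFree (ModuleCat.{u} Λ)) (hΓ : StronglyCMFree (ModuleCat.{u} Γ)) :
    StronglyCMFree (ModuleCat.{u} (UpperTriangular Λ M Γ)) :=
  stronglyCMFree_iff.2 fun _ hK W =>
    HomExact.middle (triangle_shortExact W) hK.projective
      (homExact_restrict_left hM hΛ hΓ hK _) (homExact_restrict_right hM hΓ hK _)

end UpperTriangular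

end

end TriCM

theorem corollary3p10 {Λ Γ M : Type u} [Ring Λ] [Ring Γ] [AddCommGroup M]
    [Module Λ M] [Module Γᵐᵒᵖ M] [SMulCommClass Λ Γᵐᵒᵖ M]
    (hflat : TriCM.HasFiniteFlatDimensionRight Γ M)
    (hproj : TriCM.HasFiniteProjectiveDimension Λ M) :
    TriCM.StronglyLeftCMFree (TriCM.UpperTriangular Λ M Γ) ↔
      TriCM.StronglyLeftCMFree Λ ∧ TriCM.StronglyLeftCMFree Γ :=
  ⟨fun h => ⟨TriCM.UpperTriangular.stronglyCMFree_left hproj h,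
    TriCM.UpperTriangular.stronglyCMFree_right hflat h⟩,
  fun h => TriCM.UpperTriangular.stronglyCMFree hproj h.1 h.2⟩
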